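/- Let $w_1,\dots,w_n\in\mathbb C$ be distinct, let $\mu_1,\dots,\mu_n\ge 1$ be integers, and put $$p(z)=\prod_{j=1}^n (z-w_j)^{\mu_j},\qquad N=\sum_{j=1}^n\mu_j,\qquad Z(z)=\begin{pmatrix}1&z&\cdots&z^{N-1}\end{pmatrix}.$$ Let $\Omega\subset\mathbb C$ be an open (possibly disconnected) set containing $w_1,\dots,w_n$, and let $K:\Omega\times\Omega\to\mathbb C$ be a positive definite kernel, i.e. $K(w,z)=\overline{K(z,w)}$ and $\sum_{a,b=1}^m\overline{c_a}K(z_a,z_b)c_b\ge 0$ for all $m$, all $z_1,\dots,z_m\in\Omega$ and all $c_1,\dots,c_m\in\mathbb C$. Assume that $K(z,w)$ is analytic in $z$ and in $\overline w$ (in each of these variables separately) on $\Omega$. Then there exist an open neighborhood $\Omega_0$ of the origin with $p^{-1}(\Omega_0)\subset\Omega$ and a $\mathbb C^{N\times N}$-valued kernel $L(z,w)$, $z,w\in\Omega_0$, which is analytic in $(z,\overline w)$ (jointly) and positive, i.e. $L(w,z)=L(z,w)^*$ and $\sum_{a,b=1}^m c_a^*L(z_a,z_b)c_b\ge 0$ for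 all $m$, all $z_1,\dots,z_m\in\Omega_0$ and all $c_1,\dots,c_m\in\mathbb C^N$, such that $$K(z,w)=Z(z)\,L(p(z),p(w))\,Z(w)^*,\qquad z,w\in p^{-1}(\Omega_0).$$ -/

import Mathlib

open scoped ComplexConjugate ComplexOrder Matrix

/-- The polynomial function `p(z) = ∏ⱼ (z - wⱼ) ^ μⱼ`. -/
noncomputable def nodePoly {n : ℕ} (w : Fin n → ℂ) (μ : Fin n → ℕ) (z : ℂ) : ℂ :=
  ∏ j, (z - w j) ^ μ j

/-- The row vector `Z(z) = (1, z, …, z ^ (N - 1))`, as a `1 × N` matrix. -/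
def powerRow (N : ℕ) (z : ℂ) : Matrix (Fin 1) (Fin N) ℂ :=
  Matrix.of fun _ k => z ^ (k : ℕ)

/-- The scalar kernel `K` is positive (semi)definite on `S`: the (possibly infinite) matrix
`(K z w)` indexed by the points of `S` is positive semidefinite, that is, it is Hermitian and
`0 ≤ ∑ₐ ∑ᵦ conj cₐ * K zₐ zᵦ * cᵦ` for all finitely many points of `S` and coefficients. -/
def IsPositiveKernelOn (S : Set ℂ) (K : ℂ → ℂ → ℂ) : Prop :=
  (Matrix.of fun z w : S => K z w).PosSemidef

/-- The `ℂ^{N × N}`-valued kernel `L` is positive on `S`: the (possibly infinite) block matrix with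
blocks `L z w`, `z, w ∈ S`, is positive semidefinite, that is, it is Hermitian and
`0 ≤ ∑ₐ ∑ᵦ cₐ* L(zₐ, zᵦ) cᵦ` for all finitely many points of `S` and vectors in `ℂ^N`. -/
def IsPositiveMatrixKernelOn {N : ℕ} (S : Set ℂ) (L : ℂ → ℂ → Matrix (Fin N) (Fin N) ℂ) : Prop :=
  (Matrix.of fun a b : S × Fin N => L a.1 b.1 a.2 b.2).PosSemidef

/-- `K(z, w)` is analytic in `z` and in `conj w` on the open set `S`, in each variable separately. -/
def IsSesquiAnalyticOn (S : Set ℂ) (K : ℂ → ℂ → ℂ) : Prop :=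
  (∀ w ∈ S, AnalyticOnNhd ℂ (fun z => K z w) S) ∧
  (∀ z ∈ S, AnalyticOnNhd ℂ (fun v => K z (conj v)) {v | conj v ∈ S})

/-- `K(z, w)` is analytic in the pair `(z, conj w)`, jointly, for `z, w` in the open set `S`. -/
def IsJointlySesquiAnalyticOn (S : Set ℂ) (K : ℂ → ℂ → ℂ) : Prop :=
  AnalyticOnNhd ℂ (fun q : ℂ × ℂ => K q.1 (conj q.2)) {q | q.1 ∈ S ∧ conj q.2 ∈ S}

/-! Write `K z w = ⟪F w, F z⟫` with `F` valued in a Hilbert space and with total range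
(`IsPositiveKernelOn.exists_gram`). Once `F` is known to be holomorphic, Cauchy's formula on small
circles about the nodes, together with `p(t) - p(z) = (t - z) ∑ zᵏ q_k(t)`, gives `F z = ∑ zᵏ G_k(p
z)` with `G_k(ζ) = (2πi)⁻¹ ∑ⱼ ∮ q_k(t) F(t) / (p(t) - ζ) dt` holomorphic near `0`
(`exists_nodePoly_decomposition`). The Gram kernel `L_{kl}(z, v) = ⟪G_l v, G_k z⟫` is then positive
and jointly analytic, and expanding `⟪F w, F z⟫` gives the factorization.

The hard point is that separate analyticity of `K` carries no local bound on `F`; it only says that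
each `⟪F w, F ·⟫` is holomorphic. Where `F` is locally bounded, Cauchy's integral makes it
holomorphic, and Baire's theorem supplies such a point `c` near any given point. The bound is then
propagated through the Taylor coefficients `f_n` of `F` at `c`: Hartogs' lemma, applied to `w ↦ ρⁿ
⟪f_n, F w⟫`, controls `⟪f_n, f_n⟫ = ‖f_n‖²` and improves a bound `‖f_n‖ = O(s⁻ⁿ)` to `O(σ⁻ⁿ)`
whenever `σ² < sR`. Iterating reaches every radius below `R`, the radius of a disc about `c` inside
`Ω`. -/

/-! ### Hartogs' lemma via Jensen's inequality -/

section Hartogs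

open Metric MeasureTheory Filter Topology

/-- Jensen's inequality: `log ‖g‖` satisfies the sub-mean value property. -/
theorem AnalyticOnNhd.log_norm_le_circleAverage {g : ℂ → ℂ} {w : ℂ} {r : ℝ} (hr : 0 < r)
    (hg : AnalyticOnNhd ℂ g (closedBall w r)) (h0 : g w ≠ 0) :
    Real.log ‖g w‖ ≤ Real.circleAverage (fun z => Real.log ‖g z‖) w r := by
  have hg' : AnalyticOnNhd ℂ g (closedBall w |r|) := by rwa [abs_of_pos hr]
  rw [hg'.circleAverage_log_norm hr.ne' h0]
  refine le_add_of_nonneg_left (finsum_nonneg fun u => ?_)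
  by_cases hu : u ∈ closedBall w |r|
  · refine mul_nonneg ?_ ?_
    · exact_mod_cast (MeromorphicOn.AnalyticOnNhd.divisor_nonneg hg') u
    -- At the centre itself the Jensen term is `log (r * 0⁻¹) = log 0 = 0` by the default values.
    · rcases eq_or_ne w u with rfl | hne
      · simp
      · refine Real.log_nonneg ?_
        rw [← div_eq_mul_inv, one_le_div (norm_pos_iff.2 (sub_ne_zero.2 hne))]
        rwa [abs_of_pos hr, mem_closedBall, dist_comm, dist_eq_norm] at hu
  · rw [Function.locallyFinsuppWithin.apply_eq_zero_of_notMem _ hu]; simp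

/-- A two-constants estimate at the centre of a circle. -/
theorem AnalyticOnNhd.norm_le_exp_of_volume_le {g : ℂ → ℂ} {w : ℂ} {r S T η : ℝ} (hr : 0 < r)
    (hg : AnalyticOnNhd ℂ g (closedBall w r)) (hS : 0 ≤ S) (hT : 0 ≤ T)
    {A : Set ℂ} (hA : MeasurableSet A)
    (hgA : ∀ z ∈ sphere w r, z ∈ A → ‖g z‖ ≤ Real.exp T)
    (hgS : ∀ z ∈ sphere w r, ‖g z‖ ≤ Real.exp S)
    (hη : 0 ≤ η)
    (hvol : volume {θ | θ ∈ Set.Ioo (-Real.pi) Real.pi ∧ circleMap w r θ ∉ A}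
      ≤ ENNReal.ofReal (2 * Real.pi * η)) :
    ‖g w‖ ≤ Real.exp (T + η * S) := by
  by_cases h0 : g w = 0
  · rw [h0, norm_zero]; positivity
  rw [← Real.log_le_iff_le_exp (norm_pos_iff.2 h0)]
  refine (hg.log_norm_le_circleAverage hr h0).trans ?_
  have hlog : ∀ {X : ℝ} {z : ℂ}, 0 ≤ X → ‖g z‖ ≤ Real.exp X → Real.log ‖g z‖ ≤ X := by
    intro X z hX h
    rcases eq_or_ne (g z) 0 with hz | hz
    · simpa [hz] using hX
    · exact (Real.log_le_iff_le_exp (norm_pos_iff.2 hz)).2 h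
  set B : Set ℝ := {θ | circleMap w r θ ∉ A} with hB
  have hBm : MeasurableSet B := (continuous_circleMap w r).measurable hA.compl
  -- The angles are moved to `(-π, π)`, the range used by polar coordinates.
  rw [Real.circleAverage_eq_integral_add (-Real.pi), smul_eq_mul]
  rw [intervalIntegral.integral_comp_add_right
    (fun θ => Real.log ‖g (circleMap w r θ)‖) (-Real.pi)]
  have e1 : (0 : ℝ) + -Real.pi = -Real.pi := by ring
  have e2 : 2 * Real.pi + -Real.pi = Real.pi := by ring
  rw [e1, e2]
  have hpi := Real.pi_pos
  have hle : -Real.pi ≤ Real.pi := by linarith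
  have hint1 : IntervalIntegrable (fun θ => Real.log ‖g (circleMap w r θ)‖) volume
      (-Real.pi) Real.pi := by
    have h := MeromorphicOn.circleIntegrable_log_norm (c := w) (R := r) (f := g)
      (fun z hz => (hg z (by rw [abs_of_pos hr] at hz; exact sphere_subset_closedBall hz)).meromorphicAt)
    have hper : Function.Periodic (fun θ => Real.log ‖g (circleMap w r θ)‖) (2 * Real.pi) :=
      fun θ => by simp only [periodic_circleMap w r θ]
    exact hper.intervalIntegrable₀ (by positivity) h _ _
  have hint2 : IntervalIntegrable (fun θ => T + B.indicator (fun _ => S) θ) volume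
      (-Real.pi) Real.pi := by
    rw [intervalIntegrable_iff_integrableOn_Ioo_of_le hle]
    refine Integrable.add (integrable_const _) ?_
    exact (integrable_const S).indicator hBm
  have hmono : ∫ θ in (-Real.pi)..Real.pi, Real.log ‖g (circleMap w r θ)‖
      ≤ ∫ θ in (-Real.pi)..Real.pi, (T + B.indicator (fun _ => S) θ) := by
    refine intervalIntegral.integral_mono_on hle hint1 hint2 fun θ _ => ?_
    have hs : circleMap w r θ ∈ sphere w r := circleMap_mem_sphere w hr.le θ
    by_cases hθ : circleMap w r θ ∈ A
    · have : θ ∉ B := fun h => h hθ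
      simpa [this] using hlog hT (hgA _ hs hθ)
    · have : θ ∈ B := hθ
      simp only [this, Set.indicator_of_mem]
      linarith [hlog hS (hgS _ hs)]
  have hval : ∫ θ in (-Real.pi)..Real.pi, (T + B.indicator (fun _ => S) θ)
      ≤ 2 * Real.pi * T + 2 * Real.pi * η * S := by
    rw [intervalIntegral.integral_of_le hle, integral_Ioc_eq_integral_Ioo,
      integral_add (integrable_const _) ((integrable_const S).indicator hBm),
      integral_indicator_const _ hBm]
    have hv : volume.real (Set.Ioo (-Real.pi) Real.pi) = 2 * Real.pi := by
      rw [Real.volume_real_Ioo_of_le hle]; ring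
    have hb : (volume.restrict (Set.Ioo (-Real.pi) Real.pi)).real B ≤ 2 * Real.pi * η := by
      rw [measureReal_def, Measure.restrict_apply hBm]
      refine ENNReal.toReal_le_of_le_ofReal (by positivity) (le_trans (measure_mono ?_) hvol)
      exact fun θ h => ⟨h.2, h.1⟩
    simp only [integral_const, measureReal_restrict_apply_univ, hv, smul_eq_mul]
    gcongr
  calc (2 * Real.pi)⁻¹ * ∫ θ in (-Real.pi)..Real.pi, Real.log ‖g (circleMap w r θ)‖
      ≤ (2 * Real.pi)⁻¹ * (2 * Real.pi * T + 2 * Real.pi * η * S) := by gcongr; linarith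
    _ = T + η * S := by field_simp

/-- A set of small area meets some circle about a given point in a set of small angle. -/
theorem exists_circle_volume_le {A : Set ℂ} (hA : MeasurableSet A) (w : ℂ) {δ η : ℝ} (hδ : 0 < δ)
    (hη : 0 < η) (hvol : volume (ball w δ \ A) ≤ ENNReal.ofReal (Real.pi * δ ^ 2 * η / 4)) :
    ∃ r, 0 < r ∧ r < δ ∧ volume {θ | θ ∈ Set.Ioo (-Real.pi) Real.pi ∧ circleMap w r θ ∉ A}
      ≤ ENNReal.ofReal (2 * Real.pi * η) := by
  by_contra! hcon
  have hpi := Real.pi_pos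
  have hBm : MeasurableSet {z : ℂ | w + z ∈ ball w δ \ A} :=
    (measurable_const_add w) (measurableSet_ball.diff hA)
  set f : ℂ → ENNReal := {z : ℂ | w + z ∈ ball w δ \ A}.indicator 1 with hf
  have h1 : ∫⁻ z, f z = volume (ball w δ \ A) := by
    rw [hf, lintegral_indicator_one hBm]
    exact measure_preimage_add volume w _
  have hcm : ∀ r θ : ℝ, w + Complex.polarCoord.symm (r, θ) = circleMap w r θ := by
    intro r θ
    rw [Complex.polarCoord_symm_apply, circleMap, Complex.exp_mul_I]
    push_cast; ring
  -- If every circle with radius in `(δ/2, δ)` were bad, the bad area would be at least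
  -- `(δ/2)(δ/2)(2πη) = πδ²η/2`, twice the allowed amount.
  have h2 : ∫⁻ r in Set.Ioo (δ / 2) δ, ENNReal.ofReal (δ / 2) * ENNReal.ofReal (2 * Real.pi * η)
      ≤ ∫⁻ z, f z := by
    rw [← Complex.lintegral_comp_polarCoord_symm, polarCoord_target, Measure.volume_eq_prod,
      ← Measure.prod_restrict, lintegral_prod]
    · refine le_trans ?_ (lintegral_mono_set (s := Set.Ioo (δ / 2) δ) ?_)
      · refine setLIntegral_mono' measurableSet_Ioo fun r hr => ?_
        have hr0 : 0 < r := by linarith [hr.1]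
        have hm : MeasurableSet {θ : ℝ | circleMap w r θ ∉ A} :=
          (continuous_circleMap w r).measurable hA.compl
        have hinner : ∫⁻ θ in Set.Ioo (-Real.pi) Real.pi,
            ENNReal.ofReal r • f (Complex.polarCoord.symm (r, θ))
            = ENNReal.ofReal r *
              volume {θ | θ ∈ Set.Ioo (-Real.pi) Real.pi ∧ circleMap w r θ ∉ A} := by
          have : ∀ θ, ENNReal.ofReal r • f (Complex.polarCoord.symm (r, θ))
              = {θ : ℝ | circleMap w r θ ∉ A}.indicator (fun _ => ENNReal.ofReal r) θ := by
            intro θ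
            have hb : circleMap w r θ ∈ ball w δ := by
              rw [mem_ball, dist_eq_norm, circleMap_sub_center, norm_circleMap_zero,
                abs_of_pos hr0]
              exact hr.2
            have hmem : (Complex.polarCoord.symm (r, θ) : ℂ) ∈ {z : ℂ | w + z ∈ ball w δ \ A}
                ↔ circleMap w r θ ∉ A := by
              rw [Set.mem_ofPred_eq, hcm]
              exact ⟨fun h => h.2, fun h => ⟨hb, h⟩⟩
            by_cases hθ : circleMap w r θ ∈ A
            · rw [hf, Set.indicator_of_notMem (fun h => hmem.1 h hθ),
                Set.indicator_of_notMem (by simpa using hθ), smul_zero]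
            · rw [hf, Set.indicator_of_mem (hmem.2 hθ), Set.indicator_of_mem (by exact hθ)]
              simp
          simp_rw [this]
          rw [lintegral_indicator hm, lintegral_const, Measure.restrict_restrict hm,
            Measure.restrict_apply_univ, Set.inter_comm]
          rfl
        rw [hinner]
        gcongr
        · exact hr.1.le
        · exact (hcon r hr0 hr.2).le
      · exact fun r hr => (half_pos hδ).trans hr.1
    · refine AEMeasurable.smul measurable_fst.ennreal_ofReal.aemeasurable ?_
      exact ((measurable_one.indicator hBm).comp
        (by
          have : (Complex.polarCoord.symm : ℝ × ℝ → ℂ)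
            = fun p => (p.1 * (Real.cos p.2 + Real.sin p.2 * Complex.I) : ℂ) := by
              ext p; exact Complex.polarCoord_symm_apply p
          rw [this]; fun_prop)).aemeasurable
  rw [h1, lintegral_const, Measure.restrict_apply_univ, Real.volume_Ioo,
    ← ENNReal.ofReal_mul (by positivity), ← ENNReal.ofReal_mul (by positivity)] at h2
  have h3 := h2.trans hvol
  rw [ENNReal.ofReal_le_ofReal_iff (by positivity)] at h3
  have : 0 < Real.pi * δ ^ 2 * η := by positivity
  nlinarith

/-- **Hartogs' lemma** for sequences of holomorphic functions with exponential bounds: a pointwise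
bounded sequence grows subexponentially, locally uniformly. -/
theorem exists_norm_le_exp_of_pointwise_bounded {g : ℕ → ℂ → ℂ} {c : ℂ} {s : ℝ}
    (hg : ∀ n, DifferentiableOn ℂ (g n) (ball c s))
    (hexp : ∀ t < s, ∃ C κ : ℝ, 0 ≤ C ∧ 0 ≤ κ ∧
      ∀ n, ∀ z ∈ closedBall c t, ‖g n z‖ ≤ Real.exp (C + n * κ))
    (hpt : ∀ z ∈ ball c s, ∃ C : ℝ, ∀ n, ‖g n z‖ ≤ C)
    {t ε : ℝ} (hts : t < s) (hε : 0 < ε) :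
    ∃ C : ℝ, ∀ n : ℕ, ∀ z ∈ closedBall c t, ‖g n z‖ ≤ C * Real.exp (ε * n) := by
  have hpi := Real.pi_pos
  set δ := (s - t) / 2 with hδdef
  have hδ : 0 < δ := by rw [hδdef]; linarith
  obtain ⟨C, κ, hC, hκ, hCκ⟩ := hexp (t + δ) (by rw [hδdef]; linarith)
  set D := closedBall c (t + δ)
  have hDs : D ⊆ ball c s := closedBall_subset_ball (by rw [hδdef]; linarith)
  obtain ⟨η, hη, hηκ⟩ : ∃ η : ℝ, 0 < η ∧ η * κ ≤ ε :=
    ⟨ε / (κ + 1), by positivity, by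
      rw [div_mul_eq_mul_div, div_le_iff₀ (by positivity)]; nlinarith⟩
  -- By pointwise boundedness the `A m` exhaust `D`, so one `m` leaves out only a small area. The
  -- resulting bound `T + η (C + n κ)` on `log ‖g n‖` has slope at most `ε`.
  set A : ℕ → Set ℂ := fun m => D ∩ ⋂ n, {z | z ∈ D → ‖g n z‖ ≤ m} with hAdef
  have hAcl : ∀ m, IsClosed (A m) := by
    intro m
    have : A m = ⋂ n, D ∩ (fun z => ‖g n z‖) ⁻¹' Set.Iic (m : ℝ) := by
      ext z
      simp only [hAdef, Set.mem_inter_iff, Set.mem_iInter, Set.mem_ofPred_eq, Set.mem_preimage,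
        Set.mem_Iic]
      exact ⟨fun h n => ⟨h.1, h.2 n h.1⟩, fun h => ⟨(h 0).1, fun n _ => (h n).2⟩⟩
    rw [this]
    exact isClosed_iInter fun n =>
      (((hg n).continuousOn.mono hDs).norm).preimage_isClosed_of_isClosed isClosed_closedBall
        isClosed_Iic
  have hAmeas : ∀ m, MeasurableSet (A m) := fun m => (hAcl m).measurableSet
  have hlim : Tendsto (fun m => volume (D \ A m)) atTop (𝓝 0) := by
    have h := tendsto_measure_iInter_atTop (μ := volume) (s := fun m => D \ A m)
      (fun m => (measurableSet_closedBall.diff (hAmeas m)).nullMeasurableSet)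
      (fun a b hab z hz => ⟨hz.1, fun h => hz.2 ⟨h.1, Set.mem_iInter.2 fun n hD =>
        (Set.mem_iInter.1 h.2 n hD).trans (by exact_mod_cast hab)⟩⟩)
      ⟨0, ((measure_mono Set.sdiff_subset).trans_lt measure_closedBall_lt_top).ne⟩
    have he : ⋂ m, D \ A m = ∅ := by
      rw [Set.eq_empty_iff_forall_notMem]
      intro z hz
      have hzD : z ∈ D := (Set.mem_iInter.1 hz 0).1
      obtain ⟨M, hM⟩ := hpt z (hDs hzD)
      obtain ⟨m, hm⟩ := exists_nat_ge M
      exact (Set.mem_iInter.1 hz m).2 ⟨hzD, Set.mem_iInter.2 fun n _ => (hM n).trans hm⟩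
    rw [he, measure_empty] at h
    exact h
  have hpos : (0 : ENNReal) < ENNReal.ofReal (Real.pi * δ ^ 2 * η / 4) := by
    rw [ENNReal.ofReal_pos]; positivity
  obtain ⟨m, hm⟩ := ((hlim.eventually (gt_mem_nhds hpos))).exists
  obtain ⟨T, hT0, hT⟩ : ∃ T : ℝ, 0 ≤ T ∧ (m : ℝ) ≤ Real.exp T :=
    ⟨m, by positivity, by linarith [Real.add_one_le_exp (m : ℝ)]⟩
  refine ⟨Real.exp (T + η * C), fun n z hz => ?_⟩
  have hzD : closedBall z δ ⊆ D := closedBall_subset_closedBall' (by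
    rw [mem_closedBall] at hz; linarith)
  obtain ⟨r, hr0, hrδ, hr⟩ := exists_circle_volume_le (hAmeas m) z hδ hη
    ((measure_mono (Set.sdiff_subset_sdiff_left (ball_subset_closedBall.trans hzD))).trans hm.le)
  have hrD : closedBall z r ⊆ D := (closedBall_subset_closedBall hrδ.le).trans hzD
  have hA : AnalyticOnNhd ℂ (g n) (closedBall z r) :=
    ((hg n).analyticOnNhd isOpen_ball).mono (hrD.trans hDs)
  have := hA.norm_le_exp_of_volume_le hr0 (S := C + n * κ) (T := T) (η := η) (by positivity) hT0
    (hAmeas m) (fun y _ hy => ((Set.mem_iInter.1 hy.2 n) hy.1).trans hT)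
    (fun y hy => hCκ n y (hrD (sphere_subset_closedBall hy))) hη.le hr
  refine this.trans ?_
  rw [← Real.exp_add]
  refine Real.exp_le_exp.2 ?_
  nlinarith [mul_le_mul_of_nonneg_right hηκ (Nat.cast_nonneg (α := ℝ) n)]

end Hartogs

/-! ### Weak holomorphy implies holomorphy -/

section WeaklyHolomorphic

open Metric Filter Topology Submodule
open scoped InnerProductSpace

variable {H : Type*} [NormedAddCommGroup H] [InnerProductSpace ℂ H]

/-- The bound extends by closedness to `v = x`, where it reads `‖x‖² ≤ M ‖x‖`. It turns norm bounds
on `F` into scalar bounds against the span of its values, where holomorphy is known. -/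
theorem Submodule.norm_le_of_forall_norm_inner_le {V : Submodule ℂ H} (hV : Dense (V : Set H))
    {x : H} {M : ℝ} (hM : 0 ≤ M) (h : ∀ v ∈ V, ‖⟪v, x⟫_ℂ‖ ≤ M * ‖v‖) : ‖x‖ ≤ M := by
  have h' : ‖⟪x, x⟫_ℂ‖ ≤ M * ‖x‖ :=
    hV.induction (P := fun v => ‖⟪v, x⟫_ℂ‖ ≤ M * ‖v‖) h
      (isClosed_le (by fun_prop) (by fun_prop)) x
  rcases (norm_nonneg x).eq_or_lt with h0 | h0
  · rwa [← h0]
  · rw [inner_self_eq_norm_sq_to_K] at h'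
    norm_num at h'
    nlinarith

theorem eq_of_forall_inner_eq_of_dense_span {s : Set H} (hs : Dense (span ℂ s : Set H)) {x y : H}
    (h : ∀ v ∈ s, ⟪v, x⟫_ℂ = ⟪v, y⟫_ℂ) : x = y := by
  have hz : ‖x - y‖ ≤ 0 := norm_le_of_forall_norm_inner_le hs le_rfl fun v hv => by
    have : ⟪v, x⟫_ℂ = ⟪v, y⟫_ℂ := by
      induction hv using span_induction with
      | mem v hv => exact h v hv
      | zero => simp
      | add u v _ _ hu hv => simp only [inner_add_left, hu, hv]
      | smul c u _ hu => simp only [inner_smul_left, hu]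
    rw [inner_sub_right, this]; simp
  exact sub_eq_zero.1 (norm_le_zero_iff.1 hz)

theorem differentiableOn_inner_of_mem_span {F : ℂ → H} {Ω : Set ℂ}
    (hF : ∀ w ∈ Ω, DifferentiableOn ℂ (fun z => ⟪F w, F z⟫_ℂ) Ω) {v : H}
    (hv : v ∈ span ℂ (F '' Ω)) : DifferentiableOn ℂ (fun z => ⟪v, F z⟫_ℂ) Ω := by
  induction hv using span_induction with
  | mem v hv => obtain ⟨w, hw, rfl⟩ := hv; exact hF w hw
  | zero => simp
  | add u v _ _ hu hv => simpa only [inner_add_left] using hu.fun_add hv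
  | smul c u _ hu => simpa only [inner_smul_left] using hu.const_mul _

/-- By Baire's theorem `F` is bounded on some small disc near any given point. -/
theorem exists_ball_norm_le_of_weaklyHolomorphic {F : ℂ → H} {Ω : Set ℂ}
    (hd : Dense (span ℂ (F '' Ω) : Set H))
    (hF : ∀ w ∈ Ω, DifferentiableOn ℂ (fun z => ⟪F w, F z⟫_ℂ) Ω) {b : ℂ} {r : ℝ} (hr : 0 < r)
    (hb : closedBall b r ⊆ Ω) :
    ∃ c ∈ ball b r, ∃ M : ℝ, ∀ᶠ z in 𝓝 c, ‖F z‖ ≤ M := by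
  set A : ℕ → Set ℂ := fun m => closedBall b r ∩ {z | ‖F z‖ ≤ m} with hA
  have hAcl : ∀ m, IsClosed (A m) := by
    intro m
    have : A m = closedBall b r ∩ ⋂ v ∈ span ℂ (F '' Ω),
        closedBall b r ∩ (fun z => ‖⟪v, F z⟫_ℂ‖) ⁻¹' Set.Iic (m * ‖v‖) := by
      ext z
      simp only [hA, Set.mem_inter_iff, Set.mem_iInter, Set.mem_ofPred_eq, Set.mem_preimage,
        Set.mem_Iic]
      refine ⟨fun h => ⟨h.1, fun v _ => ⟨h.1, (norm_inner_le_norm _ _).trans ?_⟩⟩,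
        fun h => ⟨h.1, norm_le_of_forall_norm_inner_le hd (by positivity) fun v hv => (h.2 v hv).2⟩⟩
      rw [mul_comm]
      gcongr
      exact h.2
    rw [this]
    exact isClosed_closedBall.inter (isClosed_biInter fun v hv =>
      (((differentiableOn_inner_of_mem_span hF hv).continuousOn.mono
        hb).norm).preimage_isClosed_of_isClosed isClosed_closedBall isClosed_Iic)
  have hdense := dense_iUnion_interior_of_closed (f := fun m => A m ∪ (ball b r)ᶜ)
    (fun m => (hAcl m).union isOpen_ball.isClosed_compl) (by
      refine Set.eq_univ_of_forall fun z => Set.mem_iUnion.2 ?_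
      by_cases hz : z ∈ ball b r
      · obtain ⟨m, hm⟩ := exists_nat_ge ‖F z‖
        exact ⟨m, Or.inl ⟨ball_subset_closedBall hz, hm⟩⟩
      · exact ⟨0, Or.inr hz⟩)
  obtain ⟨c, hc, hcm⟩ := hdense.inter_open_nonempty _ isOpen_ball ⟨b, mem_ball_self hr⟩
  obtain ⟨m, hm⟩ := Set.mem_iUnion.1 hcm
  refine ⟨c, hc, m, ?_⟩
  filter_upwards [mem_interior_iff_mem_nhds.1 hm, isOpen_ball.mem_nhds hc] with z hz hzb
  rcases hz with hz | hz
  · exact hz.2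
  · exact absurd hzb hz

/-- Cauchy's estimate bounds the derivative of each `⟪v, F ·⟫` by `‖v‖ M / r`; linearity in `‖v‖`
lets the estimate pass to the norm. The norm continuity obtained makes the Cauchy integral of `F`
available. -/
theorem lipschitzOnWith_of_weaklyHolomorphic {F : ℂ → H} {Ω : Set ℂ}
    (hd : Dense (span ℂ (F '' Ω) : Set H))
    (hF : ∀ w ∈ Ω, DifferentiableOn ℂ (fun z => ⟪F w, F z⟫_ℂ) Ω) {c : ℂ} {r M : ℝ} (hr : 0 < r)
    (hc : closedBall c (2 * r) ⊆ Ω) (hM : ∀ z ∈ closedBall c (2 * r), ‖F z‖ ≤ M) :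
    ∀ z ∈ closedBall c r, ∀ y ∈ closedBall c r, ‖F z - F y‖ ≤ M / r * ‖z - y‖ := by
  have hM0 : 0 ≤ M := (norm_nonneg _).trans (hM c (mem_closedBall_self (by linarith)))
  intro z hz y hy
  refine norm_le_of_forall_norm_inner_le hd (by positivity) fun v hv => ?_
  have hdv := differentiableOn_inner_of_mem_span hF hv
  have hsub : ∀ x ∈ closedBall c r, closedBall x r ⊆ closedBall c (2 * r) := fun x hx =>
    closedBall_subset_closedBall' (by rw [mem_closedBall] at hx; linarith)
  have hderiv : ∀ x ∈ closedBall c r, ‖deriv (fun z => ⟪v, F z⟫_ℂ) x‖ ≤ ‖v‖ * M / r := by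
    intro x hx
    refine Complex.norm_deriv_le_of_forall_mem_sphere_norm_le hr ?_ fun p hp => ?_
    · exact (hdv.mono ((closure_ball_subset_closedBall.trans (hsub x hx)).trans hc)).diffContOnCl
    · refine (norm_inner_le_norm _ _).trans ?_
      gcongr
      exact hM p (hsub x hx (sphere_subset_closedBall hp))
  have hat : ∀ x ∈ closedBall c r, DifferentiableAt ℂ (fun z => ⟪v, F z⟫_ℂ) x := fun x hx =>
    hdv.differentiableAt (mem_of_superset (closedBall_mem_nhds x hr) ((hsub x hx).trans hc))
  have := (convex_closedBall c r).norm_image_sub_le_of_norm_deriv_le hat hderiv hy hz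
  rw [inner_sub_right]
  refine this.trans (le_of_eq ?_)
  ring

variable [CompleteSpace H]

theorem inner_circleIntegral {f : ℂ → H} {c : ℂ} {r : ℝ} (hf : CircleIntegrable f c r) (v : H) :
    ⟪v, ∮ z in C(c, r), f z⟫_ℂ = ∮ z in C(c, r), ⟪v, f z⟫_ℂ := by
  rw [circleIntegral, circleIntegral, ← innerSL_apply_apply ℂ v,
    ← ContinuousLinearMap.intervalIntegral_comp_comm _ hf.out]
  simp

/-- The Cauchy integral of `F` is a power series, and by the scalar Cauchy formula it has the same
inner products as `F` with a total set. -/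
theorem analyticAt_of_weaklyHolomorphic_of_bounded {F : ℂ → H} {Ω : Set ℂ} (hΩ : IsOpen Ω)
    (hd : Dense (span ℂ (F '' Ω) : Set H))
    (hF : ∀ w ∈ Ω, DifferentiableOn ℂ (fun z => ⟪F w, F z⟫_ℂ) Ω) {c : ℂ} (hc : c ∈ Ω) {M : ℝ}
    (hM : ∀ᶠ z in 𝓝 c, ‖F z‖ ≤ M) : AnalyticAt ℂ F c := by
  obtain ⟨ρ, hρ, hρΩ⟩ := nhds_basis_closedBall.mem_iff.1 ((hΩ.mem_nhds hc) |> inter_mem hM)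
  lift ρ to NNReal using hρ.le
  set r : NNReal := ρ / 2 with hrdef
  have hr : 0 < r := by rw [hrdef]; exact half_pos (by exact_mod_cast hρ)
  have h2r : (2 * r : ℝ) = ρ := by rw [hrdef]; push_cast; ring
  have hlip := lipschitzOnWith_of_weaklyHolomorphic hd hF (r := r) (c := c) (M := M)
    (by exact_mod_cast hr) (by rw [h2r]; exact fun z hz => (hρΩ hz).2)
    (by rw [h2r]; exact fun z hz => (hρΩ hz).1)
  have hcont : ContinuousOn F (closedBall c r) := by
    have : LipschitzOnWith (Real.toNNReal (M / r)) F (closedBall c r) :=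
      LipschitzOnWith.of_dist_le_mul fun x hx y hy => by
        rw [dist_eq_norm, dist_eq_norm]
        exact (hlip x hx y hy).trans (by gcongr; exact Real.le_coe_toNNReal _)
    exact this.continuousOn
  have hint : CircleIntegrable F c r :=
    (hcont.mono sphere_subset_closedBall).circleIntegrable r.coe_nonneg
  have hrΩ : closedBall c r ⊆ Ω := fun z hz => (hρΩ (closedBall_subset_closedBall
    (by rw [← h2r]; linarith [r.coe_nonneg]) hz)).2
  have hps := hasFPowerSeriesOn_cauchy_integral hint hr
  refine (hps.analyticAt).congr ?_
  filter_upwards [ball_mem_nhds c (show (0 : ℝ) < r from hr)] with w hw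
  refine eq_of_forall_inner_eq_of_dense_span hd ?_
  rintro _ ⟨u, hu, rfl⟩
  have hw' : ∀ z ∈ sphere c (r : ℝ), z - w ≠ 0 := by
    intro z hz h
    rw [sub_eq_zero.1 h] at hz
    rw [mem_ball] at hw; rw [mem_sphere] at hz; linarith
  rw [inner_smul_right, inner_circleIntegral]
  · have hD : DiffContOnCl ℂ (fun z => ⟪F u, F z⟫_ℂ) (ball c r) :=
      ((hF u hu).mono (closure_ball_subset_closedBall.trans hrΩ)).diffContOnCl
    have := hD.circleIntegral_sub_inv_smul hw
    simp only [inner_smul_right, smul_eq_mul] at this ⊢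
    rw [this, inv_mul_cancel_left₀ Complex.two_pi_I_ne_zero]
  · refine ContinuousOn.circleIntegrable r.coe_nonneg (ContinuousOn.smul ?_
      (hcont.mono sphere_subset_closedBall))
    exact (by fun_prop : ContinuousOn (fun z => z - w) _).inv₀ hw'

theorem iteratedDeriv_inner_right {F : ℂ → H} {c : ℂ} (hF : AnalyticAt ℂ F c) (v : H) (n : ℕ) :
    iteratedDeriv n (fun z => ⟪v, F z⟫_ℂ) c = ⟪v, iteratedDeriv n F c⟫_ℂ := by
  have := (innerSL ℂ v).iteratedFDeriv_comp_left (hF.contDiffAt (n := ⊤)) (i := n) le_top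
  have h2 := congrArg (fun m => m (fun _ => (1 : ℂ))) this
  simpa [iteratedDeriv, Function.comp_def] using h2

/-- The Taylor coefficients of `F` at `c` satisfy the Cauchy bounds of every scalar function
`⟪F w, F ·⟫`, on the largest disc on which the latter is holomorphic. -/
theorem hasSum_inner_taylor {F : ℂ → H} {Ω : Set ℂ}
    (hF : ∀ w ∈ Ω, DifferentiableOn ℂ (fun z => ⟪F w, F z⟫_ℂ) Ω) {c : ℂ} {R : ℝ}
    (hR : ball c R ⊆ Ω) (hc : AnalyticAt ℂ F c) {w z : ℂ} (hw : w ∈ Ω) (hz : z ∈ ball c R) :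
    HasSum (fun n => ⟪F w, (z - c) ^ n • (n.factorial : ℂ)⁻¹ • iteratedDeriv n F c⟫_ℂ)
      ⟪F w, F z⟫_ℂ := by
  have h := Complex.hasSum_taylorSeries_on_ball ((hF w hw).mono hR) hz
  refine h.congr_fun fun n => ?_
  rw [iteratedDeriv_inner_right hc, inner_smul_right, inner_smul_right, smul_eq_mul, smul_eq_mul]
  ring

/-- The radius is limited only by the domain of the scalar function; `F` need only be analytic at
`c`. It serves both for `h = F w` and for `h` a Taylor coefficient of `F`. -/
theorem norm_inner_taylorCoeff_le {h : H} {F : ℂ → H} {c : ℂ} {ρ C : ℝ} (hρ : 0 < ρ)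
    (hF : DiffContOnCl ℂ (fun z => ⟪h, F z⟫_ℂ) (ball c ρ)) (hc : AnalyticAt ℂ F c)
    (hC : ∀ z ∈ sphere c ρ, ‖⟪h, F z⟫_ℂ‖ ≤ C) (n : ℕ) :
    ‖⟪h, (n.factorial : ℂ)⁻¹ • iteratedDeriv n F c⟫_ℂ‖ ≤ C / ρ ^ n := by
  rw [inner_smul_right, ← iteratedDeriv_inner_right hc, norm_mul, norm_inv, Complex.norm_natCast]
  have h0 : (0 : ℝ) < n.factorial := by positivity
  rw [inv_mul_le_iff₀ h0, ← mul_div_assoc]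
  exact Complex.norm_iteratedDeriv_le_of_forall_mem_sphere_norm_le n hρ hF hC

/-- If the Taylor coefficients of `F` at `c` are `O(s⁻ⁿ)`, then `F` is bounded on smaller discs. -/
theorem exists_norm_le_of_taylorCoeff_bound {F : ℂ → H} {Ω : Set ℂ}
    (hd : Dense (span ℂ (F '' Ω) : Set H))
    (hF : ∀ w ∈ Ω, DifferentiableOn ℂ (fun z => ⟪F w, F z⟫_ℂ) Ω) {c : ℂ} {R : ℝ}
    (hR : ball c R ⊆ Ω) (hc : AnalyticAt ℂ F c) {s C : ℝ} (hs : 0 < s)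
    (hC : ∀ n : ℕ, ‖(n.factorial : ℂ)⁻¹ • iteratedDeriv n F c‖ * s ^ n ≤ C) {t : ℝ} (ht : t < s)
    (htR : t < R) : ∃ M, ∀ z ∈ closedBall c t, ‖F z‖ ≤ M := by
  refine ⟨C / (1 - t / s), fun z hz => ?_⟩
  have ht0 : 0 ≤ t := dist_nonneg.trans hz
  have hq0 : 0 ≤ t / s := by positivity
  have hq1 : t / s < 1 := (div_lt_one hs).2 ht
  have hterm : ∀ n : ℕ, ‖(z - c) ^ n • (n.factorial : ℂ)⁻¹ • iteratedDeriv n F c‖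
      ≤ C * (t / s) ^ n := by
    intro n
    rw [norm_smul, norm_pow, div_pow, mul_div_assoc', le_div_iff₀ (by positivity), mul_assoc,
      mul_comm C]
    have : ‖z - c‖ ≤ t := by rwa [mem_closedBall, dist_eq_norm] at hz
    gcongr
    exact hC n
  have hgeo := (hasSum_geometric_of_lt_one hq0 hq1).mul_left C
  have hsum := Summable.of_norm_bounded hgeo.summable hterm
  have hz' : z ∈ ball c R := by rw [mem_closedBall] at hz; rw [mem_ball]; linarith
  have hFz : F z = ∑' n : ℕ, (z - c) ^ n • (n.factorial : ℂ)⁻¹ • iteratedDeriv n F c := by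
    refine eq_of_forall_inner_eq_of_dense_span hd ?_
    rintro _ ⟨w, hw, rfl⟩
    exact (hasSum_inner_taylor hF hR hc hw hz').unique (hsum.hasSum.mapL (innerSL ℂ (F w)))
  rw [hFz]
  exact (tsum_of_norm_bounded hgeo hterm).trans_eq (div_eq_mul_inv _ _).symm

/-- For fixed `w`, Cauchy bounds `ρⁿ ⟪f_n, F w⟫` for any `ρ < R`, though not uniformly in `w`. On
`|w - c| < s` these functions are holomorphic with exponential bounds, so Hartogs' lemma makes the
growth uniformly subexponential for `|w - c| ≤ t < s`. A second Cauchy estimate, in `w`, yields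
`‖f_n‖² ≤ C' e^{εn} / (ρt)ⁿ`. -/
theorem exists_taylorCoeff_bound_step {F : ℂ → H} {Ω : Set ℂ} (hΩ : IsOpen Ω)
    (hd : Dense (span ℂ (F '' Ω) : Set H))
    (hF : ∀ w ∈ Ω, DifferentiableOn ℂ (fun z => ⟪F w, F z⟫_ℂ) Ω) {c : ℂ} {R : ℝ}
    (hR : ball c R ⊆ Ω) (hc : AnalyticAt ℂ F c) {s : ℝ} (hs : 0 < s) (hsR : s < R)
    (hC : ∃ C, ∀ n : ℕ, ‖(n.factorial : ℂ)⁻¹ • iteratedDeriv n F c‖ * s ^ n ≤ C) {σ : ℝ}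
    (hσ : 0 < σ) (hσs : σ ^ 2 < s * R) :
    ∃ C, ∀ n : ℕ, ‖(n.factorial : ℂ)⁻¹ • iteratedDeriv n F c‖ * σ ^ n ≤ C := by
  obtain ⟨C, hC⟩ := hC
  set f : ℕ → H := fun n => (n.factorial : ℂ)⁻¹ • iteratedDeriv n F c with hf
  have hC0 : 0 ≤ C := le_trans (by positivity) (hC 0)
  -- As `σ² < sR`, there are `t < s` and `ρ < R` with `σ² < tρ`, and `e^ε = tρ/σ²`; `ρ ≥ s` keeps
  -- the rate `log (ρ/s)` nonnegative.
  obtain ⟨t, ρ, ε, ht0, hts, hρ0, hsρ, hρR, hε, htρ⟩ : ∃ t ρ ε : ℝ, 0 < t ∧ t < s ∧ 0 < ρ ∧ s ≤ ρ ∧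
      ρ < R ∧ 0 < ε ∧ σ ^ 2 * Real.exp ε ≤ t * ρ := by
    have h1 : σ ^ 2 / R < s := by rw [div_lt_iff₀ (hs.trans hsR)]; exact hσs
    obtain ⟨t, ht1, ht2⟩ := exists_between h1
    have ht0 : 0 < t := lt_trans (by have := hs.trans hsR; positivity) ht1
    have h2 : σ ^ 2 / t < R := by
      rw [div_lt_iff₀ ht0]; rw [div_lt_iff₀ (hs.trans hsR)] at ht1; linarith
    obtain ⟨ρ, hρ1, hρ2⟩ := exists_between (max_lt h2 hsR)
    have hρ3 := (le_max_left _ _).trans_lt hρ1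
    have hρ4 := (le_max_right _ _).trans_lt hρ1
    rw [div_lt_iff₀ ht0] at hρ3
    have hσ2 : 0 < σ ^ 2 := by positivity
    have h5 : 1 < t * ρ / σ ^ 2 := by rw [one_lt_div hσ2]; linarith
    refine ⟨t, ρ, Real.log (t * ρ / σ ^ 2), ht0, ht2, hs.trans hρ4, hρ4.le, hρ2,
      Real.log_pos h5, ?_⟩
    rw [Real.exp_log (by linarith)]
    field_simp
    rfl
  have hbd : ∀ t' < s, ∃ M, ∀ z ∈ closedBall c t', ‖F z‖ ≤ M := fun t' ht' =>
    exists_norm_le_of_taylorCoeff_bound hd hF hR hc hs hC ht' (ht'.trans hsR)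
  have hsΩ : ball c s ⊆ Ω := (ball_subset_ball hsR.le).trans hR
  have hFd : DifferentiableOn ℂ F (ball c s) := by
    intro z hz
    obtain ⟨t', h1, h2⟩ := exists_between (mem_ball.1 hz)
    obtain ⟨M, hM⟩ := hbd t' h2
    exact (analyticAt_of_weaklyHolomorphic_of_bounded hΩ hd hF (hsΩ hz)
      (Filter.mem_of_superset (isOpen_ball.mem_nhds (mem_ball.2 h1))
        fun y hy => hM y (ball_subset_closedBall hy))).differentiableAt.differentiableWithinAt
  have hinner : ∀ n, DifferentiableOn ℂ (fun w => ⟪f n, F w⟫_ℂ) (ball c s) := fun n =>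
    (innerSL ℂ (f n)).differentiable.comp_differentiableOn hFd
  obtain ⟨C', hC'⟩ := exists_norm_le_exp_of_pointwise_bounded
    (g := fun n w => (ρ : ℂ) ^ n * ⟪f n, F w⟫_ℂ) (c := c) (s := s) (t := t) (ε := ε)
    (fun n => (hinner n).const_mul _)
    (by
      intro t' ht'
      obtain ⟨M, hM⟩ := hbd t' ht'
      have hκ : 1 ≤ ρ / s := (one_le_div hs).2 hsρ
      refine ⟨C * |M|, Real.log (ρ / s), by positivity, Real.log_nonneg hκ, fun n z hz => ?_⟩
      rw [Real.exp_add, Real.exp_nat_mul, Real.exp_log (by linarith), norm_mul, norm_pow,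
        Complex.norm_real, Real.norm_of_nonneg hρ0.le]
      calc ρ ^ n * ‖⟪f n, F z⟫_ℂ‖ ≤ ρ ^ n * (‖f n‖ * ‖F z‖) := by
            gcongr; exact norm_inner_le_norm _ _
        _ = (‖f n‖ * s ^ n) * ‖F z‖ * (ρ / s) ^ n := by rw [div_pow]; field_simp
        _ ≤ C * |M| * (ρ / s) ^ n := by
            gcongr
            · exact hC n
            · exact (hM z hz).trans (le_abs_self M)
        _ ≤ Real.exp (C * |M|) * (ρ / s) ^ n := by
            gcongr; linarith [Real.add_one_le_exp (C * |M|)])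
    (by
      intro w hw
      have hρΩ : closedBall c ρ ⊆ Ω := (closedBall_subset_ball hρR).trans hR
      have hcont := (((hF w (hsΩ hw)).mono hρΩ).continuousOn.norm.mono sphere_subset_closedBall)
      obtain ⟨B, hB⟩ := ((isCompact_sphere c ρ).image_of_continuousOn hcont).bddAbove
      refine ⟨B, fun n => ?_⟩
      have := norm_inner_taylorCoeff_le (h := F w) hρ0
        ((hF w (hsΩ hw)).mono (closure_ball_subset_closedBall.trans hρΩ)).diffContOnCl hc
        (fun z hz => hB ⟨z, hz, rfl⟩) n
      rw [le_div_iff₀ (by positivity), norm_inner_symm] at this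
      rw [norm_mul, norm_pow, Complex.norm_real, Real.norm_of_nonneg hρ0.le, mul_comm]
      exact this)
    hts hε
  have hC'0 : 0 ≤ C' := by
    have := (norm_nonneg _).trans (hC' 0 c (mem_closedBall_self ht0.le))
    simpa using this
  refine ⟨Real.sqrt C', fun n => Real.le_sqrt_of_sq_le ?_⟩
  have htΩ : closedBall c t ⊆ ball c s := closedBall_subset_ball hts
  have hb : ∀ z ∈ sphere c t, ‖⟪f n, F z⟫_ℂ‖ ≤ C' * Real.exp (ε * n) / ρ ^ n := by
    intro z hz
    rw [le_div_iff₀ (by positivity)]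
    have := hC' n z (sphere_subset_closedBall hz)
    rwa [norm_mul, norm_pow, Complex.norm_real, Real.norm_of_nonneg hρ0.le, mul_comm] at this
  -- The `n`-th Taylor coefficient of `⟪f n, F ·⟫` at `c` is `⟪f n, f n⟫`.
  have hnn := norm_inner_taylorCoeff_le ht0
    ((hinner n).mono (closure_ball_subset_closedBall.trans htΩ)).diffContOnCl hc hb n
  change ‖⟪f n, f n⟫_ℂ‖ ≤ _ at hnn
  rw [inner_self_eq_norm_sq_to_K] at hnn
  have hnn' : ‖f n‖ ^ 2 ≤ C' * Real.exp (ε * n) / ρ ^ n / t ^ n := by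
    simpa using hnn
  rw [div_div, le_div_iff₀ (by positivity), ← mul_pow] at hnn'
  have hexp : Real.exp (ε * n) = Real.exp ε ^ n := by rw [mul_comm, Real.exp_nat_mul]
  rw [hexp] at hnn'
  refine le_of_mul_le_mul_right (a := Real.exp ε ^ n) ?_ (by positivity)
  calc (‖f n‖ * σ ^ n) ^ 2 * Real.exp ε ^ n = ‖f n‖ ^ 2 * (σ ^ 2 * Real.exp ε) ^ n := by
        rw [mul_pow, mul_pow, ← pow_mul, ← pow_mul, mul_comm n 2]; ring
    _ ≤ ‖f n‖ ^ 2 * (ρ * t) ^ n := by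
        refine mul_le_mul_of_nonneg_left (pow_le_pow_left₀ (by positivity) ?_ n) (by positivity)
        linarith
    _ ≤ _ := hnn'

/-- The supremum `d` of the admissible radii cannot lie below `R`: an admissible `a > d²/R` would
make every radius below both `√(aR)` and `R` admissible, and `√(aR) > d`. -/
theorem exists_taylorCoeff_bound {F : ℂ → H} {Ω : Set ℂ} (hΩ : IsOpen Ω)
    (hd : Dense (span ℂ (F '' Ω) : Set H))
    (hF : ∀ w ∈ Ω, DifferentiableOn ℂ (fun z => ⟪F w, F z⟫_ℂ) Ω) {c : ℂ} {R : ℝ}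
    (hR : ball c R ⊆ Ω) (hc : AnalyticAt ℂ F c) {s : ℝ} (hs : 0 < s) (hsR : s < R) :
    ∃ C, ∀ n : ℕ, ‖(n.factorial : ℂ)⁻¹ • iteratedDeriv n F c‖ * s ^ n ≤ C := by
  set S : Set ℝ := {s | 0 < s ∧ s < R ∧
    ∃ C, ∀ n : ℕ, ‖(n.factorial : ℂ)⁻¹ • iteratedDeriv n F c‖ * s ^ n ≤ C} with hS
  have hdown : ∀ a ∈ S, ∀ b, 0 < b → b ≤ a → b ∈ S := by
    rintro a ⟨ha0, haR, C, hC⟩ b hb hba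
    exact ⟨hb, hba.trans_lt haR, C, fun n => (hC n).trans' (by gcongr)⟩
  have hne : S.Nonempty := by
    obtain ⟨ρ, hρ, hρd⟩ := nhds_basis_closedBall.mem_iff.1 hc.eventually_analyticAt
    set r := min ρ (s / 2) with hr
    have hr0 : 0 < r := lt_min hρ (by linarith)
    have hdiff : DifferentiableOn ℂ F (closedBall c r) := fun z hz =>
      (hρd (closedBall_subset_closedBall (min_le_left _ _) hz)).differentiableAt.differentiableWithinAt
    obtain ⟨B, hB⟩ := ((isCompact_sphere c r).image_of_continuousOn
      (hdiff.continuousOn.norm.mono sphere_subset_closedBall)).bddAbove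
    refine ⟨r, hr0, by linarith [min_le_right ρ (s / 2)], B, fun n => ?_⟩
    have := Complex.norm_iteratedDeriv_le_of_forall_mem_sphere_norm_le n hr0
      (hdiff.mono closure_ball_subset_closedBall).diffContOnCl (fun z hz => hB ⟨z, hz, rfl⟩)
    have h0 : (0 : ℝ) < n.factorial := by positivity
    rw [norm_smul, norm_inv, Complex.norm_natCast, ← le_div_iff₀ (by positivity),
      inv_mul_le_iff₀ h0, ← mul_div_assoc]
    exact this
  have hbdd : BddAbove S := ⟨R, fun a ha => ha.2.1.le⟩
  set d := sSup S with hdd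
  have hd0 : 0 < d := by
    obtain ⟨a, ha⟩ := hne
    exact ha.1.trans_le (le_csSup hbdd ha)
  have hdR : R ≤ d := by
    by_contra! hlt
    have h1 : d ^ 2 / R < d := by
      rw [div_lt_iff₀ (hd0.trans hlt)]; nlinarith
    obtain ⟨a, ha, hda⟩ := exists_lt_of_lt_csSup hne h1
    rw [div_lt_iff₀ (hd0.trans hlt)] at hda
    have h2 : d < Real.sqrt (a * R) := Real.lt_sqrt_of_sq_lt hda
    obtain ⟨σ, hσ1, hσ2⟩ := exists_between (lt_min h2 hlt)
    have hσ0 := hd0.trans hσ1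
    have : σ ∈ S := ⟨hσ0, hσ2.trans_le (min_le_right _ _),
      exists_taylorCoeff_bound_step hΩ hd hF hR hc ha.1 ha.2.1 ha.2.2 hσ0
        ((Real.lt_sqrt hσ0.le).1 (hσ2.trans_le (min_le_left _ _)))⟩
    exact (le_csSup hbdd this).not_gt hσ1
  obtain ⟨a, ha, hsa⟩ := exists_lt_of_lt_csSup hne (hsR.trans_le hdR)
  exact (hdown a ha s hs hsa.le).2.2

/-- A Hilbert space valued function `F` on an open set such that `z ↦ ⟪F w, F z⟫` is holomorphic for
every `w`, and whose values span a dense subspace, is holomorphic. This is Hartogs' theorem for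
positive definite kernels. -/
theorem differentiableOn_of_weaklyHolomorphic {F : ℂ → H} {Ω : Set ℂ} (hΩ : IsOpen Ω)
    (hd : Dense (span ℂ (F '' Ω) : Set H))
    (hF : ∀ w ∈ Ω, DifferentiableOn ℂ (fun z => ⟪F w, F z⟫_ℂ) Ω) : DifferentiableOn ℂ F Ω := by
  intro b hb
  obtain ⟨ρ, hρ, hρΩ⟩ := Metric.isOpen_iff.1 hΩ b hb
  -- With `c` within `r` of `b`, the disc of radius `4r` about `c` stays in `Ω`. Coefficients are
  -- controlled at `3r` and `F` on radius `2r`, which covers the disc of radius `r` about `b`.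
  set r := ρ / 5 with hr
  have hr0 : 0 < r := by positivity
  have hrΩ : closedBall b r ⊆ Ω := (closedBall_subset_ball (by linarith)).trans hρΩ
  obtain ⟨c, hcb, M, hM⟩ := exists_ball_norm_le_of_weaklyHolomorphic hd hF hr0 hrΩ
  have hcb' := mem_ball.1 hcb
  have hcΩ : c ∈ Ω := hrΩ (ball_subset_closedBall hcb)
  have hc := analyticAt_of_weaklyHolomorphic_of_bounded hΩ hd hF hcΩ hM
  have hR : ball c (4 * r) ⊆ Ω := (ball_subset_ball' (by linarith)).trans hρΩ
  obtain ⟨C, hC⟩ := exists_taylorCoeff_bound hΩ hd hF hR hc (s := 3 * r) (by linarith) (by linarith)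
  obtain ⟨M', hM'⟩ := exists_norm_le_of_taylorCoeff_bound hd hF hR hc (by linarith) hC
    (t := 2 * r) (by linarith) (by linarith)
  refine (analyticAt_of_weaklyHolomorphic_of_bounded hΩ hd hF hb
    (M := M') ?_).differentiableAt.differentiableWithinAt
  refine Filter.mem_of_superset (ball_mem_nhds b hr0) fun y hy => hM' y ?_
  rw [mem_ball] at hy
  rw [dist_comm] at hcb'
  exact (dist_triangle y b c).trans (by linarith)

end WeaklyHolomorphic

/-! ### Contour integrals and expansion in powers of `z` over functions of `p` -/

/-- With `P = X P₁ + a`, one has `P(t) - P(z) = (t - z) P₁(t) + z (P₁(t) - P₁(z))`; induct on the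
degree bound. -/
theorem Polynomial.exists_eval_sub_eval_eq {R : Type*} [CommRing R] (N : ℕ) (P : Polynomial R)
    (hP : P.natDegree ≤ N) : ∃ q : Fin N → Polynomial R, ∀ t z : R,
      P.eval t - P.eval z = (t - z) * ∑ k : Fin N, z ^ (k : ℕ) * (q k).eval t := by
  induction N generalizing P with
  | zero =>
    rw [Polynomial.eq_C_of_natDegree_le_zero hP]
    exact ⟨fun k => 0, fun t z => by simp⟩
  | succ N ih =>
    obtain ⟨q, hq⟩ := ih P.divX (by rw [Polynomial.natDegree_divX_eq_natDegree_tsub_one]; omega)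
    refine ⟨Fin.cons P.divX q, fun t z => ?_⟩
    have hev : ∀ x, P.eval x = P.divX.eval x * x + P.coeff 0 := fun x => by
      conv_lhs => rw [← Polynomial.divX_mul_X_add P]
      simp
    have hsum : ∑ k : Fin N, z ^ ((k : ℕ) + 1) * (q k).eval t
        = z * ∑ k : Fin N, z ^ (k : ℕ) * (q k).eval t := by
      rw [Finset.mul_sum]
      exact Finset.sum_congr rfl fun k _ => by ring
    rw [Fin.sum_univ_succ]
    simp only [Fin.val_zero, Fin.cons_zero, Fin.val_succ, Fin.cons_succ, pow_zero, one_mul]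
    rw [hsum, hev t, hev z]
    linear_combination z * hq t z

section Contour

open Metric Filter Topology MeasureTheory

variable {E : Type*} [NormedAddCommGroup E] [NormedSpace ℂ E]

/-- The Cauchy-type integral `ζ ↦ ∮ (φ t - ζ)⁻¹ u t dt` is holomorphic off the values of `φ`. -/
theorem differentiableOn_circleIntegral_sub_inv_smul {φ : ℂ → ℂ} {u : ℂ → E} {c : ℂ} {r ε : ℝ}
    (hr : 0 ≤ r) (hφ : ContinuousOn φ (sphere c r)) (hu : ContinuousOn u (sphere c r))
    (hε : ∀ t ∈ sphere c r, ε ≤ ‖φ t‖) :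
    DifferentiableOn ℂ (fun ζ => ∮ t in C(c, r), (φ t - ζ)⁻¹ • u t) (ball 0 ε) := by
  intro ζ hζ
  rw [mem_ball_zero_iff] at hζ
  -- Room below `ε` gives the uniform bound `‖φ t - x‖ ≥ ε - ε'` needed to differentiate under the
  -- integral.
  obtain ⟨ε', h1, h2⟩ := exists_between hζ
  have hlow : ∀ x ∈ ball (0 : ℂ) ε', ∀ t ∈ sphere c r, ε - ε' ≤ ‖φ t - x‖ := by
    intro x hx t ht
    rw [mem_ball_zero_iff] at hx
    linarith [hε t ht, norm_sub_norm_le (φ t) x]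
  have hne : ∀ x ∈ ball (0 : ℂ) ε', ∀ t ∈ sphere c r, φ t - x ≠ 0 := fun x hx t ht =>
    norm_pos_iff.1 ((sub_pos.2 h2).trans_le (hlow x hx t ht))
  have hcm : Continuous (circleMap c r) := continuous_circleMap c r
  have hms : ∀ θ, circleMap c r θ ∈ sphere c r := circleMap_mem_sphere c hr
  have hφc : Continuous fun θ => φ (circleMap c r θ) := hφ.comp_continuous hcm hms
  have huc : Continuous fun θ => u (circleMap c r θ) := hu.comp_continuous hcm hms
  have hdc : Continuous fun θ => deriv (circleMap c r) θ := by
    simp only [deriv_circleMap]; fun_prop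
  have hζ' : ζ ∈ ball (0 : ℂ) ε' := mem_ball_zero_iff.2 h1
  have hFc : ∀ x ∈ ball (0 : ℂ) ε', Continuous fun θ =>
      deriv (circleMap c r) θ • ((φ (circleMap c r θ) - x)⁻¹ • u (circleMap c r θ)) := fun x hx =>
    hdc.smul (((hφc.sub continuous_const).inv₀ fun θ => hne x hx _ (hms θ)).smul huc)
  have hF'c : Continuous fun θ => deriv (circleMap c r) θ •
      ((((φ (circleMap c r θ) - ζ) ^ 2)⁻¹) • u (circleMap c r θ)) :=
    hdc.smul ((((hφc.sub continuous_const).pow 2).inv₀ fun θ =>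
      pow_ne_zero 2 (hne ζ hζ' _ (hms θ))).smul huc)
  have key := intervalIntegral.hasDerivAt_integral_of_dominated_loc_of_deriv_le (𝕜 := ℂ)
    (μ := volume) (a := 0) (b := 2 * Real.pi) (s := ball (0 : ℂ) ε') (x₀ := ζ)
    (F := fun x θ => deriv (circleMap c r) θ •
      ((φ (circleMap c r θ) - x)⁻¹ • u (circleMap c r θ)))
    (F' := fun x θ => deriv (circleMap c r) θ •
      ((((φ (circleMap c r θ) - x) ^ 2)⁻¹) • u (circleMap c r θ)))
    (bound := fun θ => ‖deriv (circleMap c r) θ‖ *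
      (((ε - ε') ^ 2)⁻¹ * ‖u (circleMap c r θ)‖))
    (isOpen_ball.mem_nhds hζ')
    (eventually_of_mem (isOpen_ball.mem_nhds hζ') fun x hx => (hFc x hx).aestronglyMeasurable)
    ((hFc ζ hζ').intervalIntegrable _ _) hF'c.aestronglyMeasurable
    (Eventually.of_forall fun θ _ x hx => by
      have h0 := sub_pos.2 h2
      have := hlow x hx _ (hms θ)
      rw [norm_smul, norm_smul, norm_inv, norm_pow]
      gcongr)
    ((hdc.norm.mul (continuous_const.mul huc.norm)).intervalIntegrable _ _)
    (Eventually.of_forall fun θ _ x hx => by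
      have h := ((hasDerivAt_id x).const_sub (φ (circleMap c r θ))).inv (hne x hx _ (hms θ))
      have h' := (h.smul_const (u (circleMap c r θ))).const_smul (deriv (circleMap c r) θ)
      have e : -(-1) / (φ (circleMap c r θ) - id x) ^ 2
          = ((φ (circleMap c r θ) - x) ^ 2)⁻¹ := by simp
      rw [e] at h'
      exact h')
  exact key.2.differentiableAt.differentiableWithinAt

theorem exists_radius_of_injective {ι : Type*} [Finite ι] {w : ι → ℂ} (hw : Function.Injective w)
    {Ω : Set ℂ} (hΩ : IsOpen Ω) (hwΩ : ∀ j, w j ∈ Ω) :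
    ∃ r : ℝ, 0 < r ∧ (∀ j, closedBall (w j) r ⊆ Ω) ∧ ∀ i j, i ≠ j → 2 * r ≤ dist (w i) (w j) := by
  have h1 : ∀ j, ∀ᶠ r in 𝓝[>] (0 : ℝ), closedBall (w j) r ⊆ Ω := by
    intro j
    obtain ⟨ρ, hρ, h⟩ := nhds_basis_closedBall.mem_iff.1 (hΩ.mem_nhds (hwΩ j))
    filter_upwards [Ioc_mem_nhdsGT hρ] with r hr
    exact (closedBall_subset_closedBall hr.2).trans h
  have h2 : ∀ i j, ∀ᶠ r in 𝓝[>] (0 : ℝ), i ≠ j → 2 * r ≤ dist (w i) (w j) := by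
    intro i j
    rcases eq_or_ne i j with rfl | hij
    · simp
    · have : 0 < dist (w i) (w j) / 2 := half_pos (dist_pos.2 (hw.ne hij))
      filter_upwards [Ioc_mem_nhdsGT this] with r hr _
      linarith [hr.2]
  obtain ⟨r, ⟨ha, hb⟩, hr⟩ := (((eventually_all.2 h1).and
    (eventually_all.2 fun i => eventually_all.2 (h2 i))).and self_mem_nhdsWithin).exists
  exact ⟨r, hr, ha, hb⟩

theorem pow_sum_le_norm_nodePoly {n : ℕ} {w : Fin n → ℂ} {μ : Fin n → ℕ} {r : ℝ} (hr : 0 ≤ r)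
    {z : ℂ} (h : ∀ j, r ≤ ‖z - w j‖) : r ^ (∑ j, μ j) ≤ ‖nodePoly w μ z‖ := by
  rw [nodePoly, norm_prod, ← Finset.prod_pow_eq_pow_sum]
  refine Finset.prod_le_prod (fun _ _ => by positivity) fun j _ => ?_
  rw [norm_pow]
  exact pow_le_pow_left₀ hr (h j) _

/-- A holomorphic function near the zeros of `p` is a combination `∑ zᵏ G_k(p(z))` with `G_k`
holomorphic near the origin. -/
theorem exists_nodePoly_decomposition [CompleteSpace E] {n : ℕ} {w : Fin n → ℂ}
    (hw : Function.Injective w) (μ : Fin n → ℕ) {Ω : Set ℂ} (hΩ : IsOpen Ω) (hwΩ : ∀ j, w j ∈ Ω)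
    {F : ℂ → E} (hF : DifferentiableOn ℂ F Ω) :
    ∃ (ε : ℝ) (G : Fin (∑ j, μ j) → ℂ → E), 0 < ε ∧ nodePoly w μ ⁻¹' ball 0 ε ⊆ Ω ∧
      (∀ k, DifferentiableOn ℂ (G k) (ball 0 ε)) ∧
      ∀ z ∈ nodePoly w μ ⁻¹' ball 0 ε, F z = ∑ k : Fin (∑ j, μ j), z ^ (k : ℕ) • G k (nodePoly w μ z) := by
  obtain ⟨r, hr, hrΩ, hdist⟩ := exists_radius_of_injective hw hΩ hwΩ
  set P : Polynomial ℂ := ∏ j, (Polynomial.X - Polynomial.C (w j)) ^ μ j with hP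
  have hPev : ∀ z, P.eval z = nodePoly w μ z := fun z => by
    simp [hP, nodePoly, Polynomial.eval_prod]
  have hdeg : P.natDegree ≤ ∑ j, μ j := by
    refine (Polynomial.natDegree_prod_le _ _).trans (Finset.sum_le_sum fun j _ => ?_)
    simp [Polynomial.natDegree_pow]
  obtain ⟨q, hq⟩ := P.exists_eval_sub_eval_eq _ hdeg
  simp only [hPev] at hq
  have hpc : Continuous (nodePoly w μ) := by
    have : nodePoly w μ = fun z => P.eval z := funext fun z => (hPev z).symm
    rw [this]; exact P.continuous
  -- Points on the circles are at distance at least `r` from all nodes, so `|p| ≥ ε` there;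
  -- conversely `|p z| < ε` forces `z` into one of the open discs.
  set ε := r ^ (∑ j, μ j) with hε
  have hFs : ∀ j, ContinuousOn F (sphere (w j) r) := fun j =>
    hF.continuousOn.mono (sphere_subset_closedBall.trans (hrΩ j))
  have hsphere : ∀ j, ∀ t ∈ sphere (w j) r, ε ≤ ‖nodePoly w μ t‖ := by
    intro j t ht
    refine pow_sum_le_norm_nodePoly hr.le fun i => ?_
    rw [mem_sphere] at ht
    rw [← dist_eq_norm]
    rcases eq_or_ne i j with rfl | hij
    · exact ht.ge
    · have := hdist i j hij
      have h3 := dist_triangle (w i) t (w j)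
      rw [dist_comm (w i) t] at h3
      linarith
  have hnear : ∀ z ∈ nodePoly w μ ⁻¹' ball 0 ε, ∃ j, z ∈ ball (w j) r := by
    intro z hz
    by_contra! hcon
    have := pow_sum_le_norm_nodePoly (μ := μ) hr.le (z := z) (w := w) fun j => by
      have := hcon j
      rw [mem_ball, not_lt, dist_eq_norm] at this
      exact this
    rw [Set.mem_preimage, mem_ball_zero_iff] at hz
    linarith
  refine ⟨ε, fun k ζ => (2 * Real.pi * Complex.I : ℂ)⁻¹ • ∑ j, ∮ t in C(w j, r),
    (nodePoly w μ t - ζ)⁻¹ • ((q k).eval t • F t), by positivity, fun z hz => ?_, fun k => ?_,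
    fun z hz => ?_⟩
  · obtain ⟨j, hj⟩ := hnear z hz
    exact hrΩ j (ball_subset_closedBall hj)
  · refine DifferentiableOn.fun_const_smul (DifferentiableOn.fun_sum fun j _ => ?_) _
    exact differentiableOn_circleIntegral_sub_inv_smul hr.le hpc.continuousOn
      ((q k).continuous.continuousOn.smul (hFs j)) (hsphere j)
  · obtain ⟨i, hi⟩ := hnear z hz
    have hpz : ‖nodePoly w μ z‖ < ε := by simpa using hz
    have hpne : ∀ j, ∀ t ∈ sphere (w j) r, nodePoly w μ t - nodePoly w μ z ≠ 0 := by
      intro j t ht h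
      have := hsphere j t ht
      rw [sub_eq_zero.1 h] at this
      linarith
    -- Only the circle around `z` contributes; on the other closed discs the integrand is
    -- holomorphic.
    have hcauchy : ∑ j, ∮ t in C(w j, r), (t - z)⁻¹ • F t = (2 * Real.pi * Complex.I : ℂ) • F z := by
      rw [Finset.sum_eq_single i]
      · exact ((hF.mono (closure_ball_subset_closedBall.trans
          (hrΩ i))).diffContOnCl).circleIntegral_sub_inv_smul hi
      · intro j _ hji
        have hz' : ∀ t ∈ closedBall (w j) r, t - z ≠ 0 := by
          intro t ht h
          rw [sub_eq_zero.1 h, mem_closedBall] at ht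
          rw [mem_ball, dist_comm] at hi
          linarith [hdist i j hji.symm, dist_triangle (w i) z (w j)]
        refine DiffContOnCl.circleIntegral_eq_zero hr.le (DifferentiableOn.diffContOnCl ?_)
        refine DifferentiableOn.mono (t := closedBall (w j) r) ?_ closure_ball_subset_closedBall
        exact ((differentiableOn_id.sub_const z).fun_inv hz').fun_smul (hF.mono (hrΩ j))
      · simp
    have hint : ∀ j (k : Fin (∑ j, μ j)), CircleIntegrable (fun t => z ^ (k : ℕ) •
        ((nodePoly w μ t - nodePoly w μ z)⁻¹ • ((q k).eval t • F t))) (w j) r := fun j k =>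
      ContinuousOn.circleIntegrable hr.le (continuousOn_const.smul
        (((hpc.continuousOn.sub continuousOn_const).inv₀ (hpne j)).smul
          ((q k).continuous.continuousOn.smul (hFs j))))
    have hexpand : ∀ j, ∮ t in C(w j, r), (t - z)⁻¹ • F t = ∑ k : Fin (∑ j, μ j), z ^ (k : ℕ) •
        ∮ t in C(w j, r), (nodePoly w μ t - nodePoly w μ z)⁻¹ • ((q k).eval t • F t) := by
      intro j
      simp_rw [← circleIntegral.integral_smul]
      rw [← circleIntegral.integral_fun_sum fun k _ => hint j k]
      refine circleIntegral.integral_congr hr.le fun t ht => ?_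
      have h1 := hpne j t ht
      simp only [smul_smul, ← Finset.sum_smul]
      congr 1
      have h2 : t - z ≠ 0 := fun h => h1 (by rw [hq t z, h, zero_mul])
      have h3 : ∑ k : Fin (∑ j, μ j), z ^ (k : ℕ) * ((nodePoly w μ t - nodePoly w μ z)⁻¹ *
          (q k).eval t) = (nodePoly w μ t - nodePoly w μ z)⁻¹ *
          ∑ k : Fin (∑ j, μ j), z ^ (k : ℕ) * (q k).eval t := by
        rw [Finset.mul_sum]
        exact Finset.sum_congr rfl fun k _ => by ring
      rw [h3, eq_inv_mul_iff_mul_eq₀ h1, hq t z, mul_assoc, mul_comm (t - z), mul_assoc,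
        inv_mul_cancel₀ h2, mul_one]
    simp only [smul_comm _ (2 * Real.pi * Complex.I : ℂ)⁻¹, ← Finset.smul_sum]
    rw [eq_inv_smul_iff₀ Complex.two_pi_I_ne_zero, ← hcauchy]
    simp only [Finset.smul_sum, hexpand]
    rw [Finset.sum_comm]

end Contour

/-! ### Gram representations of positive kernels -/

section Kernels

open Metric Filter Topology Submodule
open scoped InnerProductSpace

/-- **Moore–Aronszajn**: a positive kernel is the Gram kernel of a total family. -/
theorem IsPositiveKernelOn.exists_gram {S : Set ℂ} {K : ℂ → ℂ → ℂ} (hK : IsPositiveKernelOn S K) :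
    ∃ (H : Type) (_ : NormedAddCommGroup H) (_ : InnerProductSpace ℂ H) (_ : CompleteSpace H)
      (F : ℂ → H), Dense (span ℂ (F '' S) : Set H) ∧
        ∀ z ∈ S, ∀ w ∈ S, ⟪F w, F z⟫_ℂ = K z w := by
  classical
  -- The transpose is needed because the reproducing property gives `⟪k w, k z⟫ = M w z 1`, which is
  -- to equal `K z w`.
  let M : Matrix S S (ℂ →L[ℂ] ℂ) := Matrix.of fun z w => K w z • ContinuousLinearMap.id ℂ ℂ
  have hM : M.PosSemidef := by
    suffices key : M.IsHermitian ∧ ∀ v : S →₀ ℂ,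
        0 ≤ RCLike.re (v.sum fun x w => v.sum fun x' w' => ⟪M x' x w, w'⟫_ℂ) from
       ((RKHS.posSemidef_tfae (K := M)).out 0 2).2 key
    refine ⟨?_, fun v => ?_⟩
    · ext z w
      have := hK.1.apply w z
      simp only [Matrix.of_apply, Complex.star_def] at this
      have hid : star (ContinuousLinearMap.id ℂ ℂ) = ContinuousLinearMap.id ℂ ℂ := star_one _
      simp [M, hid, this]
    · have := (Matrix.PosSemidef.transpose hK).2 v
      have hc : ∀ z w : S, conj (K z w) = K w z := fun z w => hK.1.apply w z
      refine (RCLike.nonneg_iff.1 this).1.trans_eq (congrArg _ ?_)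
      refine Finsupp.sum_congr fun z _ => Finsupp.sum_congr fun w _ => ?_
      simp only [M, Matrix.transpose_apply, Matrix.of_apply, smul_apply, ContinuousLinearMap.id_apply,
        smul_eq_mul, RCLike.inner_apply, map_mul, hc, Complex.star_def]
      ring
  have : Fact M.PosSemidef := ⟨hM⟩
  let k : S → RKHS.OfKernel M := fun z => RKHS.kerFun (RKHS.OfKernel M) z 1
  have hk : ∀ z w : S, ⟪k w, k z⟫_ℂ = K z w := by
    intro z w
    simp only [k, RKHS.kerFun_inner, RKHS.kerFun_apply, RKHS.OfKernel.kernel_ofKernel]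
    simp [M]
  refine ⟨RKHS.OfKernel M, inferInstance, inferInstance, inferInstance,
    fun z => if h : z ∈ S then k ⟨z, h⟩ else 0, ?_, fun z hz w hw => ?_⟩
  · have hd := RKHS.kerFun_dense (RKHS.OfKernel M)
    rw [← dense_iff_topologicalClosure_eq_top] at hd
    refine hd.mono (span_le.2 ?_)
    rintro _ ⟨z, v, rfl⟩
    have : RKHS.kerFun (RKHS.OfKernel M) z v = v • k z := by
      rw [← map_smul]; simp
    rw [this]
    exact smul_mem _ _ (subset_span ⟨z, z.2, by simp⟩)
  · simp only [hz, hw, dif_pos]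
    exact hk ⟨z, hz⟩ ⟨w, hw⟩

variable {H : Type*} [NormedAddCommGroup H] [InnerProductSpace ℂ H]

/-- The quadratic form at `x` is `‖∑ conj xᵢ • vᵢ‖²`. -/
theorem Matrix.posSemidef_of_inner {ι : Type*} (v : ι → H) :
    (Matrix.of fun a b => ⟪v b, v a⟫_ℂ).PosSemidef := by
  refine ⟨?_, fun x => ?_⟩
  · ext a b; simp
  · have : (x.sum fun i xi => x.sum fun j xj => star xi * (Matrix.of fun a b => ⟪v b, v a⟫_ℂ) i j * xj)
        = ⟪x.sum fun i xi => star xi • v i, x.sum fun i xi => star xi • v i⟫_ℂ := by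
      simp only [Finsupp.sum, inner_sum, sum_inner, inner_smul_left, inner_smul_right, Matrix.of_apply]
      refine Finset.sum_congr rfl fun a _ => ?_
      rw [Finset.mul_sum]
      refine Finset.sum_congr rfl fun b _ => ?_
      rw [starRingEnd_apply, star_star]
      ring
    rw [this, inner_self_eq_norm_sq_to_K]
    rw [← RCLike.ofReal_pow]
    exact RCLike.ofReal_nonneg.2 (sq_nonneg _)

variable [CompleteSpace H]

/-- The map `v ↦ ⟪g (conj v), ·⟫` into the dual is holomorphic, since the two conjugations cancel.
Joint analyticity then follows from that of the bilinear evaluation pairing. -/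
theorem analyticOnNhd_inner_conj {f g : ℂ → H} {U : Set ℂ} (hU : IsOpen U)
    (hf : DifferentiableOn ℂ f U) (hg : DifferentiableOn ℂ g U) :
    IsJointlySesquiAnalyticOn U (fun z v => ⟪g v, f z⟫_ℂ) := by
  rintro ⟨z, v⟩ ⟨hz, hv⟩
  have hopen : IsOpen {v : ℂ | conj v ∈ U} := hU.preimage Complex.continuous_conj
  have hD : DifferentiableOn ℂ (fun v => innerSL ℂ (g (conj v))) {v : ℂ | conj v ∈ U} := by
    intro u hu
    have hd := (hg.differentiableAt (hU.mem_nhds hu)).hasDerivAt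
    have : HasDerivAt (fun v => innerSL ℂ (g (conj v))) (innerSL ℂ (deriv g (conj u))) u := by
      rw [hasDerivAt_iff_isLittleO] at hd ⊢
      have h2 := hd.comp_tendsto (Complex.continuous_conj.tendsto u)
      refine Asymptotics.IsLittleO.of_norm_norm ((h2.norm_norm).congr (fun x => ?_) fun x => ?_)
      · rw [Function.comp_apply, ← innerSL_apply_norm (𝕜 := ℂ)]
        simp [map_sub]
      · rw [Function.comp_apply, ← map_sub, RCLike.norm_conj]
    exact this.differentiableAt.differentiableWithinAt
  have hDa : AnalyticAt ℂ (fun v => innerSL ℂ (g (conj v))) v := hD.analyticAt (hopen.mem_nhds hv)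
  have hfa : AnalyticAt ℂ f z := hf.analyticAt (hU.mem_nhds hz)
  have h1 : AnalyticAt ℂ (fun q : ℂ × ℂ => innerSL ℂ (g (conj q.2))) (z, v) :=
    hDa.comp_of_eq analyticAt_snd rfl
  have h2 : AnalyticAt ℂ (fun q : ℂ × ℂ => f q.1) (z, v) := hfa.comp_of_eq analyticAt_fst rfl
  exact ((ContinuousLinearMap.id ℂ (H →L[ℂ] ℂ)).analyticAt_bilinear
    (innerSL ℂ (g (conj v)), f z)).comp_of_eq (h1.prod h2) rfl

end Kernels

theorem proposition5p1 {n : ℕ} (w : Fin n → ℂ) (hw : Function.Injective w)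
    (μ : Fin n → ℕ) (hμ : ∀ j, 1 ≤ μ j)
    (Ω : Set ℂ) (hΩ : IsOpen Ω) (hwΩ : ∀ j, w j ∈ Ω)
    (K : ℂ → ℂ → ℂ) (hK : IsPositiveKernelOn Ω K) (hKan : IsSesquiAnalyticOn Ω K) :
    ∃ (Ω₀ : Set ℂ) (L : ℂ → ℂ → Matrix (Fin (∑ j, μ j)) (Fin (∑ j, μ j)) ℂ),
      IsOpen Ω₀ ∧ (0 : ℂ) ∈ Ω₀ ∧
      nodePoly w μ ⁻¹' Ω₀ ⊆ Ω ∧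
      IsPositiveMatrixKernelOn Ω₀ L ∧
      (∀ i j, IsJointlySesquiAnalyticOn Ω₀ (fun z v => L z v i j)) ∧
      ∀ z ∈ nodePoly w μ ⁻¹' Ω₀, ∀ v ∈ nodePoly w μ ⁻¹' Ω₀,
        K z v = (powerRow (∑ j, μ j) z * L (nodePoly w μ z) (nodePoly w μ v) *
          (powerRow (∑ j, μ j) v)ᴴ) 0 0 := by
  
  obtain ⟨H, _, _, _, F, hd, hFK⟩ := hK.exists_gram
  have hF : DifferentiableOn ℂ F Ω := by
    refine differentiableOn_of_weaklyHolomorphic hΩ hd fun v hv => ?_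
    exact ((hKan.1 v hv).differentiableOn).congr fun z hz => hFK z hz v hv
  obtain ⟨ε, G, hε, hsub, hG, hdec⟩ := exists_nodePoly_decomposition hw μ hΩ hwΩ hF
  refine ⟨Metric.ball 0 ε, fun z v => Matrix.of fun k l => inner ℂ (G l v) (G k z), Metric.isOpen_ball,
    Metric.mem_ball_self hε, hsub, ?_, fun k l => ?_, fun z hz v hv => ?_⟩
  · exact Matrix.posSemidef_of_inner fun a : Metric.ball (0 : ℂ) ε × Fin (∑ j, μ j) => G a.2 a.1
  · exact analyticOnNhd_inner_conj Metric.isOpen_ball (hG k) (hG l)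
  · rw [← hFK z (hsub hz) v (hsub hv), hdec z hz, hdec v hv]
    simp only [sum_inner, inner_sum, inner_smul_left, inner_smul_right, Matrix.mul_apply,
      powerRow, Matrix.of_apply, Matrix.conjTranspose_apply, Finset.sum_mul, Finset.mul_sum, Complex.star_def]
    rw [Finset.sum_comm]
    exact Finset.sum_congr rfl fun l _ => Finset.sum_congr rfl fun k _ => by ring
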